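/- Let $K$ be an algebraically closed field and let $A$ be a finite-dimensional associative unital $K$-algebra (for instance $A = KQ/I$ for a quiver $Q$ and an admissible ideal $I$). All modules are finite-dimensional left $A$-modules. For a module $V$ with minimal projective presentation $P_1 \xrightarrow{p} P_0 \to V \to 0$, let $\tau_A V = \operatorname{Hom}_K(\operatorname{Tr} V, K)$, where $\operatorname{Tr} V = \operatorname{Coker}\bigl(\operatorname{Hom}_A(P_0,A) \xrightarrow{-\circ p} \operatorname{Hom}_A(P_1,A)\bigr)$, be its Auslander-Reiten translate. A module $V$ is called $\tau$-rigid if $\operatorname{Hom}_A(V,\tau_A V)=0$, and $A$ is called $\tau$-tilting finite if there are only finitely many isomorphism classes of indecomposable $\tau$-rigid $A$-modules, and $\tau$-tilting infinite otherwise. Then: (a) For every $d \ge 0$ there are only finitely many isomorphism classes of $\tau$-rigid $A$-modules $V$ with $\dim_K V = d$. (b) If $A$ is $\tau$-tilting infinite, then for every $d \ge 0$ there exists an indecomposable $\tau$-rigid $A$-module $V$ with $\dim_K V \ge d$. -/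

import Mathlib

open CategoryTheory MulOpposite

universe u v

namespace TauTilting

noncomputable section

/-- A submodule `N` of `M` is superfluous (small) if `N + U = M` forces `U = M`. -/
def IsSuperfluous {A : Type v} [Ring A] {M : Type v} [AddCommGroup M] [Module A M]
    (N : Submodule A M) : Prop :=
  ∀ U : Submodule A M, N ⊔ U = ⊤ → U = ⊤

section ProjectivePresentations

variable (A : Type v) [Ring A]

/-- A minimal projective presentation `P₁ → P₀ → V → 0`: an exact sequence of finitely generated
modules with `P₀`, `P₁` projective in which `P₀ → V` and `P₁ → im p = ker q` are projective
covers. -/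
structure MinimalProjectivePresentation (V : Type v) [AddCommGroup V] [Module A V] where
  P₁ : ModuleCat.{v} A
  P₀ : ModuleCat.{v} A
  finite₁ : Module.Finite A P₁
  finite₀ : Module.Finite A P₀
  projective₁ : Module.Projective A P₁
  projective₀ : Module.Projective A P₀
  p : P₁ →ₗ[A] P₀
  q : P₀ →ₗ[A] V
  surjective : Function.Surjective q
  exact : Function.Exact p q
  minimal₀ : IsSuperfluous (LinearMap.ker q)
  minimal₁ : IsSuperfluous (LinearMap.ker p)

/-- Over an Artinian ring, every finitely generated module has a projective cover. -/
theorem exists_projectiveCover [IsArtinianRing A] (V : Type v) [AddCommGroup V] [Module A V]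
    [Module.Finite A V] :
    ∃ (P : ModuleCat.{v} A) (q : P →ₗ[A] V), Module.Finite A P ∧ Module.Projective A P ∧
      Function.Surjective q ∧ IsSuperfluous (LinearMap.ker q) := by
  obtain ⟨n, f, hf⟩ := Module.Finite.exists_fin' A V
  let S : Set (Submodule A (Fin n → A)) :=
    {U | Module.Projective A U ∧ Function.Surjective (f.domRestrict U)}
  have hS : S.Nonempty := by
    refine ⟨⊤, ?_, ?_⟩
    · exact Module.Projective.of_equiv (Submodule.topEquiv (R := A) (M := Fin n → A)).symm
    · intro y
      obtain ⟨x, rfl⟩ := hf y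
      exact ⟨⟨x, trivial⟩, rfl⟩
  obtain ⟨P, ⟨hP, hsurj⟩, hmin⟩ := IsArtinian.set_has_minimal S hS
  set q : P →ₗ[A] V := f.domRestrict P with hq
  refine ⟨ModuleCat.of A P, q, ?_, hP, hsurj, ?_⟩
  · change Module.Finite A P
    infer_instance
  change ∀ U : Submodule A P, LinearMap.ker q ⊔ U = ⊤ → U = ⊤
  intro U hU
  have hqU : Function.Surjective (q.domRestrict U) := by
    intro y
    obtain ⟨x, rfl⟩ := hsurj y
    obtain ⟨k, hk, z, hz, rfl⟩ := Submodule.mem_sup.1 (hU ▸ Submodule.mem_top : x ∈ _ ⊔ U)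
    refine ⟨⟨z, hz⟩, ?_⟩
    rw [LinearMap.mem_ker] at hk
    simp [hk]
  obtain ⟨h, hh⟩ := Module.projective_lifting_property (q.domRestrict U) q hqU
  let e : Module.End A P := U.subtype ∘ₗ h
  have he : ∀ x, q (e x) = q x := fun x => LinearMap.congr_fun hh x
  have hen : ∀ (n : ℕ) x, q ((e ^ n) x) = q x := by
    intro n
    induction n with
    | zero => intro x; rfl
    | succ n ih => intro x; rw [pow_succ, Module.End.mul_apply, ih, he]
  obtain ⟨N, hN⟩ := Filter.eventually_atTop.1 e.eventually_isCompl_ker_pow_range_pow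
  have hc := hN (N + 1) (Nat.le_succ N)
  set R : Submodule A P := LinearMap.range (e ^ (N + 1)) with hR
  have hRproj : Module.Projective A R :=
    Module.Projective.of_split R.subtype (R.projectionOnto _ hc.symm)
      (by ext x; simp)
  have hmem : R.map P.subtype ∈ S := by
    refine ⟨Module.Projective.of_equiv
      (Submodule.equivMapOfInjective P.subtype P.subtype_injective R), ?_⟩
    intro y
    obtain ⟨x, rfl⟩ := hsurj y
    exact ⟨⟨_, Submodule.mem_map_of_mem (LinearMap.mem_range_self (e ^ (N + 1)) x)⟩,
      hen (N + 1) x⟩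
  have hRtop : R = ⊤ := by
    by_contra hne
    refine hmin _ hmem (lt_of_le_of_ne (Submodule.map_subtype_le P R) fun heq => hne ?_)
    apply Submodule.map_injective_of_injective P.subtype_injective
    rw [heq, Submodule.map_subtype_top]
  rw [eq_top_iff, ← hRtop]
  rintro _ ⟨x, rfl⟩
  rw [pow_succ', Module.End.mul_apply]
  exact (h _).2

theorem nonempty_minimalProjectivePresentation [IsArtinianRing A] (V : Type v) [AddCommGroup V]
    [Module A V] [Module.Finite A V] : Nonempty (MinimalProjectivePresentation A V) := by
  obtain ⟨P₀, q, f₀, p₀, hq, m₀⟩ := exists_projectiveCover A V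
  obtain ⟨P₁, r, f₁, p₁, hr, m₁⟩ := exists_projectiveCover A (LinearMap.ker q)
  refine ⟨⟨P₁, P₀, f₁, f₀, p₁, p₀, (LinearMap.ker q).subtype ∘ₗ r, q, hq, ?_, m₀, ?_⟩⟩
  · rw [LinearMap.exact_iff, LinearMap.range_comp, LinearMap.range_eq_top.2 hr,
      Submodule.map_subtype_top]
  · rwa [LinearMap.ker_comp_of_ker_eq_bot _ (Submodule.ker_subtype _)]

end ProjectivePresentations

section Translation

variable (K : Type u) [Field K] {A : Type v} [Ring A] [Algebra K A]

/-- For a left module homomorphism `p : P₁ → P₀`, the induced homomorphism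
`Hom_A(P₀, A) → Hom_A(P₁, A)`, `g ↦ g ∘ p`, of right `A`-modules. The right action on
`Hom_A(P, A)` is `(f · a) x = f x * a`. -/
def starMap {P₁ P₀ : Type v} [AddCommGroup P₁] [Module A P₁] [AddCommGroup P₀] [Module A P₀]
    (p : P₁ →ₗ[A] P₀) : (P₀ →ₗ[A] A) →ₗ[Aᵐᵒᵖ] (P₁ →ₗ[A] A) where
  toFun g := g ∘ₗ p
  map_add' _ _ := rfl
  map_smul' _ _ := rfl

/-- The transpose `Tr`: the right `A`-module `Coker (Hom_A(P₀, A) → Hom_A(P₁, A))`. -/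
abbrev Transpose {P₁ P₀ : Type v} [AddCommGroup P₁] [Module A P₁] [AddCommGroup P₀] [Module A P₀]
    (p : P₁ →ₗ[A] P₀) : Type v :=
  (P₁ →ₗ[A] A) ⧸ LinearMap.range (starMap p)

/-- The `K`-dual `D N = Hom_K(N, K)` of a right `A`-module `N`. -/
def RightDual (A : Type v) [Ring A] [Algebra K A] (N : Type v) [AddCommGroup N] [Module K N]
    [Module Aᵐᵒᵖ N] [IsScalarTower K Aᵐᵒᵖ N] : Type (max u v) :=
  N →ₗ[K] K

instance instAddCommGroupRightDual (N : Type v) [AddCommGroup N] [Module K N] [Module Aᵐᵒᵖ N]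
    [IsScalarTower K Aᵐᵒᵖ N] : AddCommGroup (RightDual K A N) :=
  inferInstanceAs (AddCommGroup (N →ₗ[K] K))

/-- The left `A`-module structure on `D N`, `(a · φ) n = φ (n · a)`. -/
instance instModuleRightDual (N : Type v) [AddCommGroup N] [Module K N] [Module Aᵐᵒᵖ N]
    [IsScalarTower K Aᵐᵒᵖ N] : Module A (RightDual K A N) where
  smul a φ := LinearMap.comp (show N →ₗ[K] K from φ)
    (Module.toModuleEnd K (S := Aᵐᵒᵖ) N (op a))
  one_smul φ := LinearMap.ext fun n => congrArg (show N →ₗ[K] K from φ) (one_smul Aᵐᵒᵖ n)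
  mul_smul a b φ := LinearMap.ext fun n =>
    congrArg (show N →ₗ[K] K from φ) (mul_smul (op b) (op a) n)
  smul_zero _ := LinearMap.zero_comp _
  smul_add _ _ _ := LinearMap.add_comp _ _ _
  add_smul a b φ := LinearMap.ext fun n =>
    (congrArg (show N →ₗ[K] K from φ) (add_smul (op a) (op b) n)).trans (map_add _ _ _)
  zero_smul φ := LinearMap.ext fun n =>
    (congrArg (show N →ₗ[K] K from φ) (zero_smul Aᵐᵒᵖ n)).trans (map_zero _)

/-- A (chosen) minimal projective presentation of a finite-dimensional module; it is unique up to
isomorphism. -/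
def minimalPresentation [FiniteDimensional K A] (V : FGModuleCat.{v} A) :
    MinimalProjectivePresentation A V :=
  haveI : IsArtinianRing A := IsArtinianRing.of_finite K A
  (nonempty_minimalProjectivePresentation A V).some

/-- The Auslander-Reiten translation `τ_A V = D Tr V`. -/
abbrev ARTranslate [FiniteDimensional K A] (V : FGModuleCat.{v} A) : Type (max u v) :=
  RightDual K A (Transpose (minimalPresentation K V).p)

/-- `V` is `τ`-rigid if `Hom_A(V, τ_A V) = 0`. -/
def IsTauRigid [FiniteDimensional K A] (V : FGModuleCat.{v} A) : Prop :=
  ∀ f : V →ₗ[A] ARTranslate K V, f = 0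

/-- The dimension of an `A`-module over the ground field `K`. -/
def dim (V : FGModuleCat.{v} A) : ℕ :=
  letI : Module K V := Module.restrictScalars K A V
  Module.finrank K V

end Translation

/-- The set of isomorphism classes of finite-dimensional `A`-modules with a given property. -/
def isoClasses {A : Type v} [Ring A] (P : FGModuleCat.{v} A → Prop) :
    Set (Quotient (isIsomorphicSetoid (FGModuleCat.{v} A))) :=
  Quotient.mk _ '' {V | P V}

/-- `A` is `τ`-tilting finite: up to isomorphism there are only finitely many indecomposable
`τ`-rigid `A`-modules. -/
def IsTauTiltingFinite (K : Type u) [Field K] (A : Type v) [Ring A] [Algebra K A]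
    [FiniteDimensional K A] : Prop :=
  (isoClasses fun V : FGModuleCat.{v} A => Indecomposable V.obj ∧ IsTauRigid K V).Finite

end

end TauTilting

/-! A `τ`-rigid module is determined by the two terms of its minimal projective presentation `p : P₁
→ P₀`. Vanishing of `Hom(V, τV)` forces every map `P₁ → V` to factor through `p`
(`exists_comp_eq_of_hom_transpose_eq_zero`), and lifting gives `Hom(P₁, P₀) = p End(P₁) + End(P₀)
p`. So the tangent space to the orbit of `p` under `Aut P₁ × Aut P₀` is everything, and the orbit
ought to be dense; two dense orbits in an affine space meet. The geometry is replaced by a line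
argument: such an orbit contains all but finitely many points of each line through `p`
(`IsRigidHom.finite_setOf_not_equiv`), so over an infinite field the orbits of `p` and `p'` meet on
the line joining them.

In dimension `d` the terms `P₁`, `P₀` have bounded length, which leaves finitely many pairs and
gives (a). Part (b) follows: a bound on the dimensions would leave finitely many classes. -/

namespace TauTilting

/-! ### Polynomial functions and linear systems depending on a parameter -/

section PolynomialFunctions

variable {K : Type*} [Field K]

/-- The algebra of polynomial functions on the affine line. -/
noncomputable def polyFun (K : Type*) [Field K] : Subalgebra K (K → K) :=
  (Polynomial.aeval (id : K → K)).range

theorem id_mem_polyFun : (fun t => t) ∈ polyFun K :=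
  ⟨Polynomial.X, by simp; rfl⟩

theorem const_mem_polyFun (c : K) : (fun _ => c) ∈ polyFun K :=
  (polyFun K).algebraMap_mem c

theorem finite_zeros_of_mem_polyFun {f : K → K} (hf : f ∈ polyFun K) {s : K} (hs : f s ≠ 0) :
    {t | f t = 0}.Finite := by
  obtain ⟨P, hP⟩ := hf
  have hev : ∀ t, f t = P.eval t := by
    intro t
    rw [← hP]
    change (Pi.evalAlgHom K (fun _ : K => K) t) (Polynomial.aeval (id : K → K) P) = _
    rw [← Polynomial.aeval_algHom_apply]
    simp [Polynomial.aeval_def, Polynomial.eval₂_eq_eval_map]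
  have hP0 : P ≠ 0 := by
    rintro rfl
    exact hs (by simp [hev])
  exact (Polynomial.finite_setOfPred_isRoot hP0).subset fun t ht => by
    simpa [Polynomial.IsRoot, hev] using ht

theorem sum_mem_polyFun {ι : Type*} (s : Finset ι) {f : ι → K → K}
    (h : ∀ i ∈ s, f i ∈ polyFun K) : (fun t => ∑ i ∈ s, f i t) ∈ polyFun K := by
  have := (polyFun K).sum_mem h
  convert this using 1
  ext t; simp

theorem det_mem_polyFun {n : Type*} [Fintype n] [DecidableEq n] {M : K → Matrix n n K}
    (h : ∀ i j, (fun t => M t i j) ∈ polyFun K) : (fun t => (M t).det) ∈ polyFun K := by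
  simp only [Matrix.det_apply]
  refine sum_mem_polyFun _ fun σ _ => ?_
  have : (fun t => ∏ i, M t (σ i) i) ∈ polyFun K := by
    have := (polyFun K).prod_mem (t := Finset.univ) fun i _ => h (σ i) i
    convert this using 1
    ext t; simp
  exact (polyFun K).toSubring.zsmul_mem this (Equiv.Perm.sign σ : ℤ)

theorem adjugate_mem_polyFun {n : Type*} [Fintype n] [DecidableEq n] {M : K → Matrix n n K}
    (h : ∀ i j, (fun t => M t i j) ∈ polyFun K) (i j : n) :
    (fun t => (M t).adjugate i j) ∈ polyFun K := by
  simp only [Matrix.adjugate_apply]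
  refine det_mem_polyFun fun k l => ?_
  by_cases hk : k = j
  · subst hk
    simpa using const_mem_polyFun _
  · simpa [Matrix.updateRow_ne hk] using h k l

/-- Let `L₀` be a surjective linear map and `x₀` an element of its kernel with `F x₀` invertible,
where `F` is linear with values in the endomorphisms of a finite-dimensional space. Then for all but
finitely many `t` the kernel of `L₀ + t L₁` contains an `x` with `F x` invertible. -/
theorem finite_setOf_not_exists_isUnit_of_surjective {X Y W : Type*} [AddCommGroup X] [Module K X]
    [AddCommGroup Y] [Module K Y] [FiniteDimensional K Y]
    [AddCommGroup W] [Module K W] [FiniteDimensional K W]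
    (L₀ L₁ : X →ₗ[K] Y) (hL : Function.Surjective L₀) (F : X →ₗ[K] Module.End K W) {x₀ : X}
    (hx₀ : L₀ x₀ = 0) (hF : IsUnit (F x₀)) :
    {t : K | ¬ ∃ x, (L₀ + t • L₁) x = 0 ∧ IsUnit (F x)}.Finite := by
  classical
  obtain ⟨S, hS⟩ := L₀.exists_rightInverse_of_surjective (LinearMap.range_eq_top.2 hL)
  let b := Module.finBasis K Y
  let c := Module.finBasis K W
  let N := LinearMap.toMatrix b b (L₁ ∘ₗ S)
  let M : K → Matrix _ _ K := fun t => 1 + t • N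
  have hM : ∀ i j, (fun t => M t i j) ∈ polyFun K := fun i j =>
    (polyFun K).add_mem (const_mem_polyFun _)
      ((polyFun K).mul_mem id_mem_polyFun (const_mem_polyFun _))
  have hLS : ∀ t, (L₀ + t • L₁) ∘ₗ S = Matrix.toLin b b (M t) := by
    intro t
    rw [LinearMap.add_comp, hS, LinearMap.smul_comp, map_add, Matrix.toLin_one, map_smul,
      Matrix.toLin_toMatrix]
  -- Cramer's rule: this is `det (M t)` times the solution `x₀ - S (M t)⁻¹ (t L₁ x₀)`. Clearing the
  -- denominator makes it polynomial in `t` and defined also where `M t` is singular; at `t = 0` it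
  -- is `x₀`.
  let x : K → X := fun t =>
    (M t).det • x₀ - S (Matrix.toLin b b (M t).adjugate (t • L₁ x₀))
  have hker : ∀ t, (L₀ + t • L₁) (x t) = 0 := by
    intro t
    have h1 : (L₀ + t • L₁) (S (Matrix.toLin b b (M t).adjugate (t • L₁ x₀))) =
        (M t).det • t • L₁ x₀ := by
      rw [← LinearMap.comp_apply, hLS, ← LinearMap.comp_apply, ← Matrix.toLin_mul,
        Matrix.mul_adjugate, map_smul (Matrix.toLin b b), Matrix.toLin_one]
      rfl
    simp only [x]
    rw [map_sub, h1, map_smul, LinearMap.add_apply, hx₀, zero_add, LinearMap.smul_apply, sub_self]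
  have hdual : ∀ φ : X →ₗ[K] K, (fun t => φ (x t)) ∈ polyFun K := by
    intro φ
    have : ∀ t, φ (x t) = (M t).det * φ x₀ -
        ∑ i, (∑ j, (M t).adjugate i j * (t * b.repr (L₁ x₀) j)) * φ (S (b i)) := by
      intro t
      simp only [x, map_sub, map_smul, smul_eq_mul, Matrix.toLin_apply, Matrix.mulVec, dotProduct,
        map_sum]
      congr 1
      rw [Finset.mul_sum]
      refine Finset.sum_congr rfl fun i _ => ?_
      rw [← mul_assoc, Finset.mul_sum]
      congr 1
      exact Finset.sum_congr rfl fun j _ => by ring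
    simp only [this]
    refine (polyFun K).sub_mem ((polyFun K).mul_mem (det_mem_polyFun hM) (const_mem_polyFun _))
      (sum_mem_polyFun _ fun i _ => (polyFun K).mul_mem (sum_mem_polyFun _ fun j _ => ?_)
        (const_mem_polyFun _))
    exact (polyFun K).mul_mem (adjugate_mem_polyFun hM i j)
      ((polyFun K).mul_mem id_mem_polyFun (const_mem_polyFun _))
  have hdet : (fun t => (LinearMap.toMatrix c c (F (x t))).det) ∈ polyFun K :=
    det_mem_polyFun fun i j => by
      simp only [LinearMap.toMatrix_apply]
      exact hdual (c.coord i ∘ₗ (LinearMap.applyₗ (c j)) ∘ₗ F)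
  have h0 : x 0 = x₀ := by simp [x, M]
  refine (finite_zeros_of_mem_polyFun hdet (s := 0) ?_).subset ?_
  · rw [h0, LinearMap.det_toMatrix]
    exact (hF.map LinearMap.det).ne_zero
  · intro t ht
    by_contra hne
    refine ht ⟨x t, hker t, ?_⟩
    rw [Set.mem_ofPred_eq, LinearMap.det_toMatrix] at hne
    exact (LinearMap.isUnit_iff_isUnit_det _).2 (isUnit_iff_ne_zero.2 hne)

end PolynomialFunctions

/-! ### Rigid morphisms between projective modules -/

section Rigidity

variable {K : Type*} [Field K] {A : Type*} [Ring A] [Algebra K A]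
  {P₁ P₀ : Type*} [AddCommGroup P₁] [Module A P₁] [AddCommGroup P₀] [Module A P₀]

/-- A morphism `p : P₁ → P₀` is rigid if it has no nonzero morphism to its shift in the homotopy
category of complexes. -/
def IsRigidHom (p : P₁ →ₗ[A] P₀) : Prop :=
  ∀ h : P₁ →ₗ[A] P₀, ∃ (a : P₁ →ₗ[A] P₁) (b : P₀ →ₗ[A] P₀), h = p ∘ₗ a + b ∘ₗ p

/-- Write `q f = g p` and lift `g` to `b : P₀ → P₀`. Then `f - b p` lands in `ker q = im p`, so it
lifts through `p` because `P₁` is projective. -/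
theorem isRigidHom_of_forall_factors [Module.Projective A P₁] [Module.Projective A P₀]
    {V : Type*} [AddCommGroup V] [Module A V] {p : P₁ →ₗ[A] P₀} {q : P₀ →ₗ[A] V}
    (hq : Function.Surjective q) (hpq : Function.Exact p q)
    (h : ∀ f : P₁ →ₗ[A] V, ∃ g : P₀ →ₗ[A] V, g ∘ₗ p = f) : IsRigidHom p := by
  intro f
  obtain ⟨g, hg⟩ := h (q ∘ₗ f)
  obtain ⟨b, hb⟩ := Module.projective_lifting_property q g hq
  have hmem : ∀ x, (f - b ∘ₗ p) x ∈ LinearMap.range p := by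
    intro x
    have h1 : q (b (p x)) = g (p x) := LinearMap.congr_fun hb (p x)
    have h2 : g (p x) = q (f x) := LinearMap.congr_fun hg x
    exact (hpq _).1 (by simp [h1, h2])
  obtain ⟨a, ha⟩ := Module.projective_lifting_property p.rangeRestrict
    ((f - b ∘ₗ p).codRestrict _ hmem) p.surjective_rangeRestrict
  refine ⟨a, b, ?_⟩
  ext x
  have : p (a x) = f x - b (p x) := congrArg Subtype.val (LinearMap.congr_fun ha x)
  simp [this]

variable [Module K P₁] [IsScalarTower K A P₁] [Module K P₀] [IsScalarTower K A P₀]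
  [FiniteDimensional K P₁] [FiniteDimensional K P₀]

/-- The orbit of a rigid morphism contains almost all points of each line through it. -/
theorem IsRigidHom.finite_setOf_not_equiv {p : P₁ →ₗ[A] P₀} (hp : IsRigidHom p)
    (r : P₁ →ₗ[A] P₀) :
    {t : K | ¬ ∃ (a : P₁ ≃ₗ[A] P₁) (b : P₀ ≃ₗ[A] P₀),
      (p + t • r) ∘ₗ a.toLinearMap = b.toLinearMap ∘ₗ p}.Finite := by
  -- A pair `(a, b)` is killed by `L₀ + t L₁` exactly when `(p + t r) a = b p`. Rigidity is
  -- surjectivity of `L₀`, the pair `(1, 1)` is the solution at `t = 0`, and `F` tests the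
  -- invertibility of `a` and `b` together.
  let L₀ : (P₁ →ₗ[A] P₁) × (P₀ →ₗ[A] P₀) →ₗ[K] (P₁ →ₗ[A] P₀) :=
    { toFun := fun x => p ∘ₗ x.1 - x.2 ∘ₗ p
      map_add' := fun x y => by ext; simp; abel
      map_smul' := fun c x => by
        ext z; simp [smul_sub, LinearMap.map_smul_of_tower] }
  let L₁ : (P₁ →ₗ[A] P₁) × (P₀ →ₗ[A] P₀) →ₗ[K] (P₁ →ₗ[A] P₀) :=
    { toFun := fun x => r ∘ₗ x.1
      map_add' := fun x y => by ext; simp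
      map_smul' := fun c x => by
        ext z; simp [LinearMap.map_smul_of_tower] }
  let F : (P₁ →ₗ[A] P₁) × (P₀ →ₗ[A] P₀) →ₗ[K] Module.End K (P₁ × P₀) :=
    { toFun := fun x => (x.1.restrictScalars K).prodMap (x.2.restrictScalars K)
      map_add' := fun x y => by ext <;> simp
      map_smul' := fun c x => by ext <;> simp }
  have hL : Function.Surjective L₀ := by
    intro h
    obtain ⟨a, b, rfl⟩ := hp h
    exact ⟨(a, -b), by ext; simp [L₀]⟩
  have : FiniteDimensional K (P₁ →ₗ[A] P₀) :=
    Module.Finite.of_injective (LinearMap.restrictScalarsₗ K A P₁ P₀ K)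
      (LinearMap.restrictScalars_injective K)
  have h0 : L₀ (LinearMap.id, LinearMap.id) = 0 := by ext; simp [L₀]
  have hF : IsUnit (F (LinearMap.id, LinearMap.id)) := by
    convert isUnit_one
    ext <;> simp [F]
  refine (finite_setOf_not_exists_isUnit_of_surjective L₀ L₁ hL F h0 hF).subset ?_
  rintro t ht ⟨⟨a, b⟩, hx, hu⟩
  have hbij : Function.Bijective (Prod.map a b) := (Module.End.isUnit_iff _).1 hu
  rw [Prod.map_bijective] at hbij
  refine ht ⟨LinearEquiv.ofBijective a hbij.1, LinearEquiv.ofBijective b hbij.2, ?_⟩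
  ext z
  have : p (a z) - b (p z) + t • r (a z) = 0 := LinearMap.congr_fun hx z
  simp only [LinearMap.comp_apply, LinearMap.add_apply, LinearMap.smul_apply,
    LinearEquiv.coe_coe, LinearEquiv.ofBijective_apply]
  rw [← sub_eq_zero, ← this]
  abel

/-- Over an infinite field, rigid morphisms with the same source and target are equivalent. -/
theorem IsRigidHom.exists_equiv [Infinite K] {p p' : P₁ →ₗ[A] P₀} (hp : IsRigidHom p)
    (hp' : IsRigidHom p') :
    ∃ (a : P₁ ≃ₗ[A] P₁) (b : P₀ ≃ₗ[A] P₀), p' ∘ₗ a.toLinearMap = b.toLinearMap ∘ₗ p := by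
  have h1 := hp.finite_setOf_not_equiv (K := K) (p' - p)
  -- The same line seen from `p'`: `p + t (p' - p) = p' + (1 - t) (p - p')`.
  have h2 := (hp'.finite_setOf_not_equiv (K := K) (p - p')).preimage
    (f := fun t => 1 - t) (sub_right_injective.injOn)
  obtain ⟨t, ht⟩ := (h1.union h2).infinite_compl.nonempty
  simp only [Set.mem_compl_iff, Set.mem_union, not_or] at ht
  obtain ⟨a, b, hab⟩ := not_not.1 ht.1
  obtain ⟨a', b', hab'⟩ := not_not.1 ht.2
  refine ⟨a.trans a'.symm, b.trans b'.symm, ?_⟩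
  ext z
  have e1 := LinearMap.congr_fun hab z
  have e2 := LinearMap.congr_fun hab' (a'.symm (a z))
  simp only [LinearMap.comp_apply, LinearEquiv.coe_coe, LinearEquiv.apply_symm_apply,
    LinearEquiv.trans_apply] at e1 e2 ⊢
  rw [← e1, LinearEquiv.eq_symm_apply, ← e2]
  simp only [LinearMap.add_apply, LinearMap.smul_apply, LinearMap.sub_apply, sub_smul, one_smul,
    smul_sub]
  abel

theorem nonempty_equiv_of_isRigidHom (K : Type*) [Field K] [Infinite K] [Algebra K A]
    [Module K P₁] [IsScalarTower K A P₁] [Module K P₀] [IsScalarTower K A P₀]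
    [FiniteDimensional K P₁] [FiniteDimensional K P₀]
    {V V' : Type*} [AddCommGroup V] [Module A V]
    [AddCommGroup V'] [Module A V'] {p p' : P₁ →ₗ[A] P₀} {q : P₀ →ₗ[A] V} {q' : P₀ →ₗ[A] V'}
    (hq : Function.Surjective q) (hpq : Function.Exact p q)
    (hq' : Function.Surjective q') (hpq' : Function.Exact p' q')
    (hp : IsRigidHom p) (hp' : IsRigidHom p') : Nonempty (V ≃ₗ[A] V') := by
  obtain ⟨a, b, hab⟩ := hp.exists_equiv (K := K) hp'
  have hmap : (LinearMap.range p).map b.toLinearMap = LinearMap.range p' := by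
    rw [← LinearMap.range_comp, ← hab, LinearMap.range_comp, LinearEquiv.range, Submodule.map_top]
  rw [LinearMap.exact_iff] at hpq hpq'
  exact ⟨(q.quotKerEquivOfSurjective hq).symm ≪≫ₗ
    Submodule.Quotient.equiv _ _ b (by rw [hpq, hpq', hmap]) ≪≫ₗ
    q'.quotKerEquivOfSurjective hq'⟩

end Rigidity

/-! ### Maps into the Auslander-Reiten translate -/

section Translate

/-- If `Hom_A(V, D Coker p^*) = 0` then every morphism `P₁ → V` factors through `p : P₁ → P₀`. -/
theorem exists_comp_eq_of_hom_transpose_eq_zero (K : Type u) [Field K] {A : Type v} [Ring A]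
    [Algebra K A] {P₁ P₀ : Type v} [AddCommGroup P₁] [Module A P₁] [AddCommGroup P₀] [Module A P₀]
    [Module.Finite A P₁] [Module.Projective A P₁]
    {V : Type v} [AddCommGroup V] [Module A V] (p : P₁ →ₗ[A] P₀)
    (h : ∀ f : V →ₗ[A] RightDual K A (Transpose p), f = 0) (f : P₁ →ₗ[A] V) :
    ∃ g : P₀ →ₗ[A] V, g ∘ₗ p = f := by
  let _ : Module K V := Module.restrictScalars K A V
  have : IsScalarTower K A V := .restrictScalars ..
  let c : (P₀ →ₗ[A] V) →ₗ[K] (P₁ →ₗ[A] V) :=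
    { toFun := fun g => g ∘ₗ p
      map_add' := fun _ _ => rfl
      map_smul' := fun _ _ => rfl }
  by_contra hf
  have hf' : f ∉ LinearMap.range c := hf
  -- A functional that kills every `g ∘ p` but not `f`. Pairing it with the maps `x ↦ g x • v`
  -- yields an `A`-linear map from `V` to `D Coker p^*`, which must vanish.
  obtain ⟨φ, hφf, hφ⟩ := Submodule.exists_le_ker_of_notMem hf'
  -- the pairing of `g : P₁ → A` with `v : V`
  let θ : V → (P₁ →ₗ[A] A) →ₗ[K] (P₁ →ₗ[A] V) := fun v =>
    { toFun := fun g => (LinearMap.toSpanSingleton A V v) ∘ₗ g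
      map_add' := fun g g' => by ext; simp [add_smul]
      map_smul' := fun k g => by ext; simp }
  let ψ : V → Transpose p →ₗ[K] K := fun v =>
    ((LinearMap.range (starMap p)).restrictScalars K).liftQ (φ ∘ₗ θ v) (by
      rintro _ ⟨g, rfl⟩
      exact hφ ⟨LinearMap.toSpanSingleton A V v ∘ₗ g, rfl⟩)
  have hψ : ∀ v g, ψ v (Submodule.Quotient.mk g) = φ (θ v g) := fun v g => rfl
  let Ψ : V →ₗ[A] RightDual K A (Transpose p) :=
    { toFun := ψ
      map_add' := fun v w => by
        refine LinearMap.ext fun x => ?_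
        obtain ⟨g, rfl⟩ := Submodule.Quotient.mk_surjective _ x
        change ψ (v + w) _ = ψ v _ + ψ w _
        rw [hψ, hψ, hψ, ← map_add]
        congr 1
        ext; simp [θ]
      map_smul' := fun a v => by
        refine LinearMap.ext fun x => ?_
        obtain ⟨g, rfl⟩ := Submodule.Quotient.mk_surjective _ x
        change ψ (a • v) _ = ψ v (Submodule.Quotient.mk (op a • g))
        rw [hψ, hψ]
        congr 1
        ext; simp [θ, mul_smul] }
  have h0 : ∀ v g, φ (θ v g) = 0 := fun v g => by
    have : ψ v = 0 := LinearMap.congr_fun (h Ψ) v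
    rw [← hψ, this]; rfl
  obtain ⟨n, s, i, -, -, hsi⟩ := Module.Finite.exists_comp_eq_id_of_projective A P₁
  apply hφf
  -- By a dual basis of the projective module `P₁`, the maps `θ v g` span `Hom(P₁, V)`, so `φ f =
  -- 0`.
  have : f = ∑ j, θ (f (s (Pi.single j 1))) (LinearMap.proj j ∘ₗ i) := by
    ext x
    have hx : s (i x) = x := LinearMap.congr_fun hsi x
    conv_lhs => rw [← hx, pi_eq_sum_univ' (i x)]
    simp [θ, Pi.single]
  rw [this, map_sum]
  exact Finset.sum_eq_zero fun j _ => h0 _ _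

end Translate

/-! ### Finitely many projective modules of bounded length -/

section FiniteUpToIso

variable {A : Type v} [Ring A]

/-- A class of modules with only finitely many isomorphism classes. -/
def FiniteUpToIso (C : ModuleCat.{v} A → Prop) : Prop :=
  ∃ s : Set (ModuleCat.{v} A), s.Finite ∧ ∀ M, C M → ∃ X ∈ s, Nonempty (M ≃ₗ[A] X)

/-- Induction along a composition series: a nonzero map to `S` either is nonzero on the submodule,
or factors through the simple quotient, which is then isomorphic to `S` by Schur's lemma. -/
theorem finiteUpToIso_simple_of_isFiniteLength {N : Type v} [AddCommGroup N] [Module A N]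
    (hN : IsFiniteLength A N) :
    FiniteUpToIso fun S : ModuleCat.{v} A => IsSimpleModule A S ∧ ∃ f : N →ₗ[A] S, f ≠ 0 := by
  induction hN with
  | of_subsingleton =>
    exact ⟨∅, Set.finite_empty, fun S ⟨_, f, hf⟩ => (hf (Subsingleton.elim _ _)).elim⟩
  | @of_simple_quotient M _ _ N _ _ ih =>
    obtain ⟨s, hs, h⟩ := ih
    refine ⟨insert (ModuleCat.of A (M ⧸ N)) s, hs.insert _, ?_⟩
    rintro S ⟨hS, f, hf⟩
    by_cases hfN : f ∘ₗ N.subtype = 0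
    · have hle : N ≤ LinearMap.ker f := fun x hx => LinearMap.congr_fun hfN ⟨x, hx⟩
      have hne : N.liftQ f hle ≠ 0 := by
        intro h0
        apply hf
        rw [← N.liftQ_mkQ f hle, h0, LinearMap.zero_comp]
      exact ⟨_, Set.mem_insert _ _,
        ⟨(LinearEquiv.ofBijective _ (LinearMap.bijective_of_ne_zero hne)).symm⟩⟩
    · obtain ⟨X, hX, e⟩ := h S ⟨hS, _, hfN⟩
      exact ⟨X, Set.mem_insert_of_mem _ hX, e⟩

theorem finiteUpToIso_simple [IsArtinianRing A] :
    FiniteUpToIso fun S : ModuleCat.{v} A => IsSimpleModule A S := by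
  obtain ⟨s, hs, h⟩ := finiteUpToIso_simple_of_isFiniteLength (A := A) (N := A)
    (isFiniteLength_iff_isNoetherian_isArtinian.2 ⟨inferInstance, inferInstance⟩)
  refine ⟨s, hs, fun S hS => h S ⟨hS, ?_⟩⟩
  have := IsSimpleModule.nontrivial A S
  obtain ⟨x, hx⟩ := exists_ne (0 : S)
  refine ⟨LinearMap.toSpanSingleton A S x, fun h0 => hx ?_⟩
  simpa using LinearMap.congr_fun h0 1

/-- Every element of `M` differs from one of `im g` by an element of `ker q`. Hence a surjection
from a projective module onto `V` lifts to one onto a projective cover of `V`. -/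
theorem IsSuperfluous.surjective_of_comp {M N V : Type v} [AddCommGroup M] [Module A M]
    [AddCommGroup N] [Module A N] [AddCommGroup V] [Module A V] {q : M →ₗ[A] V}
    (hq : IsSuperfluous (LinearMap.ker q)) (g : N →ₗ[A] M)
    (h : Function.Surjective (q ∘ₗ g)) : Function.Surjective g := by
  rw [← LinearMap.range_eq_top]
  refine hq _ (eq_top_iff.2 fun x _ => ?_)
  obtain ⟨y, hy⟩ := h (q x)
  exact Submodule.mem_sup.2 ⟨x - g y, by simpa [sub_eq_zero] using hy.symm, g y, ⟨y, rfl⟩, by simp⟩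

/-- Over an Artinian ring there are only finitely many isomorphism classes of finitely generated
projective modules of bounded length. -/
theorem finiteUpToIso_projective_length_le [IsArtinianRing A] (n : ℕ) :
    FiniteUpToIso fun P : ModuleCat.{v} A =>
      Module.Finite A P ∧ Module.Projective A P ∧ Module.length A P ≤ n := by
  induction n with
  | zero =>
    refine ⟨{ModuleCat.of A PUnit.{v + 1}}, Set.finite_singleton _, ?_⟩
    rintro P ⟨-, -, hP⟩
    have := Module.length_eq_zero_iff.1 (nonpos_iff_eq_zero.1 hP)
    exact ⟨_, rfl, ⟨(0 : P ≃ₗ[A] PUnit.{v + 1})⟩⟩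
  | succ n ih =>
    obtain ⟨s, hs, h⟩ := ih
    obtain ⟨t, ht, htS⟩ := finiteUpToIso_simple (A := A)
    have hcov : ∀ X : ModuleCat.{v} A, ∃ Q : ModuleCat.{v} A, IsSimpleModule A X →
        ∃ q : Q →ₗ[A] X, Module.Projective A Q ∧ Function.Surjective q ∧
          IsSuperfluous (LinearMap.ker q) := by
      intro X
      by_cases hX : IsSimpleModule A X
      · obtain ⟨Q, q, -, h1, h2, h3⟩ := exists_projectiveCover A X
        exact ⟨Q, fun _ => ⟨q, h1, h2, h3⟩⟩
      · exact ⟨X, fun h => (hX h).elim⟩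
    choose Q hQ using hcov
    refine ⟨insert (ModuleCat.of A PUnit.{v + 1})
      (Set.image2 (fun X (Y : ModuleCat.{v} A) => ModuleCat.of A (Q X × Y)) t s), (ht.image2 _ hs).insert _, ?_⟩
    rintro P ⟨hfin, hproj, hP⟩
    rcases subsingleton_or_nontrivial P with hsub | hnt
    · exact ⟨_, Set.mem_insert _ _, ⟨(0 : P ≃ₗ[A] PUnit.{v + 1})⟩⟩
    -- The cover of a simple quotient of `P` splits off as a direct summand; the complement `ker g`
    -- is projective of smaller length.
    obtain ⟨m, hm⟩ := IsCoatomic.exists_coatom (α := Submodule A P)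
    have hsimple : IsSimpleModule A (P ⧸ m) := isSimpleModule_iff_isCoatom.2 hm
    obtain ⟨X, hX, ⟨e⟩⟩ := htS (ModuleCat.of A (P ⧸ m)) hsimple
    have hXs : IsSimpleModule A X := IsSimpleModule.congr e.symm
    obtain ⟨q, hQp, hq, hsup⟩ := hQ X hXs
    obtain ⟨g, hg⟩ := Module.projective_lifting_property q (e.toLinearMap ∘ₗ m.mkQ) hq
    have hgs : Function.Surjective g := hsup.surjective_of_comp g (by
      rw [hg]; exact e.surjective.comp m.mkQ_surjective)
    obtain ⟨σ, hσ⟩ := Module.projective_lifting_property g LinearMap.id hgs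
    have hker : Module.Projective A (LinearMap.ker g) := by
      have hσg : ∀ x, (LinearMap.id - σ ∘ₗ g : P →ₗ[A] P) x ∈ LinearMap.ker g := fun x => by
        have : g (σ (g x)) = g x := LinearMap.congr_fun hσ (g x)
        simp [this]
      refine Module.Projective.of_split (LinearMap.ker g).subtype
        ((LinearMap.id - σ ∘ₗ g : P →ₗ[A] P).codRestrict _ hσg) (LinearMap.ext fun x => Subtype.ext ?_)
      have hx : g x = 0 := x.2
      simp [hx]
    have hlen := Module.length_eq_add_of_exact (LinearMap.ker g).subtype g
      (LinearMap.ker g).subtype_injective hgs (LinearMap.exact_subtype_ker_map g)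
    have hQnt : Nontrivial (Q X) := by
      have := IsSimpleModule.nontrivial A X
      exact hq.nontrivial
    have hQl : 1 ≤ Module.length A (Q X) := Order.one_le_iff_pos.2 Module.length_pos
    have hkl : Module.length A (LinearMap.ker g) ≤ n := by
      have h1 : Module.length A (LinearMap.ker g) + 1 ≤ (n : ℕ∞) + 1 := by
        calc _ ≤ _ := add_le_add_right hQl _
          _ ≤ _ := by rw [← hlen]; exact_mod_cast hP
      exact (ENat.add_le_add_iff_right ENat.one_ne_top).1 h1
    obtain ⟨Y, hY, ⟨e'⟩⟩ := h (ModuleCat.of A (LinearMap.ker g))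
      ⟨inferInstanceAs (Module.Finite A (LinearMap.ker g)), hker, hkl⟩
    refine ⟨_, Set.mem_insert_of_mem _ (Set.mem_image2_of_mem hX hY), ?_⟩
    have e₂ := lequivProdOfRightSplitExact (LinearMap.ker g).subtype_injective
      (LinearMap.ker g).range_subtype hσ
    exact ⟨e₂.symm ≪≫ₗ LinearEquiv.prodComm A _ _ ≪≫ₗ
      LinearEquiv.prodCongr (LinearEquiv.refl A _) e'⟩

end FiniteUpToIso

/-! ### Presentations of modules of a fixed dimension -/

section FiniteDimensionalModules

variable {K : Type u} [Field K] {A : Type v} [Ring A] [Algebra K A]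

theorem exists_surjective_of_finrank_le {V : Type v} [AddCommGroup V] [Module A V] [Module K V]
    [IsScalarTower K A V] [FiniteDimensional K V] {n : ℕ} (hn : Module.finrank K V ≤ n) :
    ∃ f : (Fin n → A) →ₗ[A] V, Function.Surjective f := by
  let b := Module.finBasis K V
  -- A `K`-basis generates `V` over `A`; zeros pad it to length `n`.
  let w : Fin n → V := fun i => if h : (i : ℕ) < Module.finrank K V then b ⟨i, h⟩ else 0
  refine ⟨Fintype.linearCombination A w, ?_⟩
  rw [← LinearMap.range_eq_top, Fintype.range_linearCombination, eq_top_iff]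
  intro x _
  rw [← b.sum_repr x]
  refine Submodule.sum_mem _ fun i _ => ?_
  rw [← algebraMap_smul A]
  refine Submodule.smul_mem _ _ (Submodule.subset_span ⟨Fin.castLE hn i, ?_⟩)
  simp [w]

/-- There are only finitely many possibilities for the terms of the minimal projective
presentations of modules of a given dimension. -/
theorem finiteUpToIso_terms_of_finrank_eq (K : Type u) [Field K] [Algebra K A]
    [FiniteDimensional K A] (d : ℕ) :
    ∃ s₁ s₀ : Set (ModuleCat.{v} A), s₁.Finite ∧ s₀.Finite ∧
      ∀ (V : Type v) [AddCommGroup V] [Module A V] [Module K V] [IsScalarTower K A V]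
        [FiniteDimensional K V], Module.finrank K V = d →
        ∀ P : MinimalProjectivePresentation A V,
          (∃ X ∈ s₁, Nonempty (P.P₁ ≃ₗ[A] X)) ∧ ∃ X ∈ s₀, Nonempty (P.P₀ ≃ₗ[A] X) := by
  have : IsArtinianRing A := IsArtinianRing.of_finite K A
  obtain ⟨l, hl⟩ := ENat.ne_top_iff_exists.1 (Module.length_ne_top (R := A)
    (M := Fin (d * Module.finrank K A) → A))
  obtain ⟨l', hl'⟩ := ENat.ne_top_iff_exists.1 (Module.length_ne_top (R := A) (M := Fin d → A))
  obtain ⟨s₁, hs₁, h₁⟩ := finiteUpToIso_projective_length_le (A := A) l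
  obtain ⟨s₀, hs₀, h₀⟩ := finiteUpToIso_projective_length_le (A := A) l'
  refine ⟨s₁, s₀, hs₁, hs₀, fun V _ _ _ _ _ hV P => ?_⟩
  have := P.projective₀
  have := P.projective₁
  let _ : Module K P.P₀ := Module.restrictScalars K A P.P₀
  have : IsScalarTower K A P.P₀ := .restrictScalars ..
  -- `A^d → V` lifts to a surjection `A^d → P₀`. Hence `dim ker q ≤ d * dim A`, and the same
  -- argument for `ker q` bounds `P₁`.
  obtain ⟨f, hf⟩ := exists_surjective_of_finrank_le (A := A) hV.le
  obtain ⟨g, hg⟩ := Module.projective_lifting_property P.q f P.surjective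
  have hgs : Function.Surjective g := P.minimal₀.surjective_of_comp g (hg ▸ hf)
  have hgs' : Function.Surjective (g.restrictScalars K) := hgs
  have : FiniteDimensional K P.P₀ := Module.Finite.of_surjective _ hgs'
  have hk : Module.finrank K (LinearMap.ker P.q) ≤ d * Module.finrank K A := by
    have h1 := LinearMap.finrank_le_finrank_of_injective
      (f := ((LinearMap.ker P.q).subtype.restrictScalars K)) (LinearMap.ker P.q).subtype_injective
    have h2 := LinearMap.finrank_le_finrank_of_surjective hgs'
    have h3 : Module.finrank K (Fin d → A) = d * Module.finrank K A := by
      simp [Module.finrank_pi_fintype]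
    exact (h1.trans h2).trans_eq h3
  have : FiniteDimensional K (LinearMap.ker P.q) :=
    Module.Finite.of_injective ((LinearMap.ker P.q).subtype.restrictScalars K)
      (LinearMap.ker P.q).subtype_injective
  obtain ⟨f', hf'⟩ := exists_surjective_of_finrank_le (A := A) hk
  let r : P.P₁ →ₗ[A] LinearMap.ker P.q := P.p.codRestrict _ fun x => P.exact.apply_apply_eq_zero x
  have hr : Function.Surjective r := by
    rintro ⟨y, hy⟩
    obtain ⟨x, rfl⟩ := (P.exact y).1 hy
    exact ⟨x, rfl⟩
  have hrs : IsSuperfluous (LinearMap.ker r) := by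
    have : LinearMap.ker r = LinearMap.ker P.p := LinearMap.ker_codRestrict _ _ _
    exact this ▸ P.minimal₁
  obtain ⟨g', hg'⟩ := Module.projective_lifting_property r f' hr
  have hgs₁ : Function.Surjective g' := hrs.surjective_of_comp g' (hg' ▸ hf')
  exact ⟨h₁ _ ⟨P.finite₁, P.projective₁, hl ▸ Module.length_le_of_surjective g' hgs₁⟩,
    h₀ _ ⟨P.finite₀, P.projective₀, hl' ▸ Module.length_le_of_surjective g hgs⟩⟩

/-- Every `τ`-rigid module is the cokernel of a rigid morphism of projective modules. -/
theorem IsTauRigid.exists_isRigidHom [FiniteDimensional K A] {V : FGModuleCat.{v} A}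
    (hV : IsTauRigid K V) {X₁ X₀ : ModuleCat.{v} A}
    (e₁ : (minimalPresentation K V).P₁ ≃ₗ[A] X₁) (e₀ : (minimalPresentation K V).P₀ ≃ₗ[A] X₀) :
    ∃ (p : X₁ →ₗ[A] X₀) (q : X₀ →ₗ[A] V), Function.Surjective q ∧ Function.Exact p q ∧
      IsRigidHom p := by
  have := (minimalPresentation K V).finite₁
  have := (minimalPresentation K V).projective₀
  have := (minimalPresentation K V).projective₁
  have hr : IsRigidHom (minimalPresentation K V).p :=
    isRigidHom_of_forall_factors (minimalPresentation K V).surjective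
      (minimalPresentation K V).exact
      (exists_comp_eq_of_hom_transpose_eq_zero K (minimalPresentation K V).p hV)
  refine ⟨e₀.toLinearMap ∘ₗ (minimalPresentation K V).p ∘ₗ e₁.symm.toLinearMap,
    (minimalPresentation K V).q ∘ₗ e₀.symm.toLinearMap,
    (minimalPresentation K V).surjective.comp e₀.symm.surjective, fun y => ?_, fun h => ?_⟩
  · rw [LinearMap.comp_apply, (minimalPresentation K V).exact]
    constructor
    · rintro ⟨x, hx⟩
      exact ⟨e₁ x, by simp [hx]⟩
    · rintro ⟨x, rfl⟩
      exact ⟨e₁.symm x, by simp⟩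
  · obtain ⟨a, b, hab⟩ := hr (e₀.symm.toLinearMap ∘ₗ h ∘ₗ e₁.toLinearMap)
    refine ⟨e₁.toLinearMap ∘ₗ a ∘ₗ e₁.symm.toLinearMap,
      e₀.toLinearMap ∘ₗ b ∘ₗ e₀.symm.toLinearMap, ?_⟩
    ext x
    have := congrArg e₀ (LinearMap.congr_fun hab (e₁.symm x))
    simpa using this

/-- Up to isomorphism, there are only finitely many `τ`-rigid modules of a given dimension. -/
theorem finite_isoClasses_isTauRigid [Infinite K] [FiniteDimensional K A] (d : ℕ) :
    (isoClasses fun V : FGModuleCat.{v} A => IsTauRigid K V ∧ dim K V = d).Finite := by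
  obtain ⟨s₁, s₀, hs₁, hs₀, h⟩ := finiteUpToIso_terms_of_finrank_eq (A := A) K d
  let C : ModuleCat.{v} A × ModuleCat.{v} A → Set (Quotient (isIsomorphicSetoid
    (FGModuleCat.{v} A))) := fun X => isoClasses fun V =>
      Module.Finite A X.1 ∧ Module.Finite A X.2 ∧
      ∃ (p : X.1 →ₗ[A] X.2) (q : X.2 →ₗ[A] V), Function.Surjective q ∧ Function.Exact p q ∧
        IsRigidHom p
  -- Rigid morphisms with the same terms have isomorphic cokernels.
  have hC : ∀ X, (C X).Subsingleton := by
    rintro ⟨X₁, X₀⟩ _ ⟨V, ⟨hf₁, hf₀, p, q, hq, hpq, hp⟩, rfl⟩ _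
      ⟨V', ⟨-, -, p', q', hq', hpq', hp'⟩, rfl⟩
    let _ : Module K X₁ := Module.restrictScalars K A X₁
    have : IsScalarTower K A X₁ := .restrictScalars ..
    let _ : Module K X₀ := Module.restrictScalars K A X₀
    have : IsScalarTower K A X₀ := .restrictScalars ..
    have : FiniteDimensional K X₁ := Module.Finite.trans A X₁
    have : FiniteDimensional K X₀ := Module.Finite.trans A X₀
    obtain ⟨e⟩ := nonempty_equiv_of_isRigidHom K hq hpq hq' hpq' hp hp'
    exact Quotient.sound ⟨e.toFGModuleCatIso⟩
  refine ((hs₁.prod hs₀).biUnion fun X _ => (hC X).finite).subset ?_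
  rintro _ ⟨V, ⟨hV, hd⟩, rfl⟩
  let _ : Module K V := Module.restrictScalars K A V
  have : IsScalarTower K A V := .restrictScalars ..
  have : FiniteDimensional K V := Module.Finite.trans A V
  obtain ⟨⟨X₁, hX₁, ⟨e₁⟩⟩, X₀, hX₀, ⟨e₀⟩⟩ := h V hd (minimalPresentation K V)
  have := (minimalPresentation K V).finite₁
  have := (minimalPresentation K V).finite₀
  exact Set.mem_biUnion (Set.mk_mem_prod hX₁ hX₀)
    ⟨V, ⟨Module.Finite.equiv e₁, Module.Finite.equiv e₀,
      hV.exists_isRigidHom e₁ e₀⟩, rfl⟩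

end FiniteDimensionalModules

end TauTilting

theorem mainTheorem4 {K : Type u} [Field K] [IsAlgClosed K] {A : Type v} [Ring A] [Algebra K A]
    [FiniteDimensional K A] :
    (∀ d : ℕ, (TauTilting.isoClasses fun V : FGModuleCat.{v} A =>
      TauTilting.IsTauRigid K V ∧ TauTilting.dim K V = d).Finite) ∧
    (¬ TauTilting.IsTauTiltingFinite K A →
      ∀ d : ℕ, ∃ V : FGModuleCat.{v} A,
        Indecomposable V.obj ∧ TauTilting.IsTauRigid K V ∧ d ≤ TauTilting.dim K V) := by
  have : Infinite K := IsAlgClosed.instInfinite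
  refine ⟨TauTilting.finite_isoClasses_isTauRigid, fun hA d => ?_⟩
  by_contra! hd
  -- If all indecomposable `τ`-rigid modules had dimension below `d`, part (a) in dimensions `0, …,
  -- d - 1` would leave finitely many classes.
  refine hA (((Finset.range d).finite_toSet.biUnion fun n _ =>
    TauTilting.finite_isoClasses_isTauRigid (K := K) (A := A) n).subset ?_)
  rintro _ ⟨V, ⟨hi, hV⟩, rfl⟩
  exact Set.mem_biUnion (by simpa using hd V hi hV) ⟨V, ⟨hV, rfl⟩, rfl⟩
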